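/- Let $n, v \ge 1$, $d \ge 1$ and $k \ge 1$ be integers, and let $t_1, \dots, t_{k-1}$ be real numbers such that the $\mathbb{Q}$-vector space $V = \mathbb{Q} + \mathbb{Q}t_1 + \cdots + \mathbb{Q}t_{k-1} \subset \mathbb{R}$ has dimension $k$ over $\mathbb{Q}$. Let $p(x_1, \dots, x_v)$, with $x_1, \dots, x_v \in \mathbb{R}^n$, be a real polynomial in the $nv$ coordinates of $x_1, \dots, x_v$, of (total) degree $d$, all of whose coefficients lie in $V$. Then there exists a set $E \subset \mathbb{R}^n$ of Hausdorff dimension exactly $\frac{n}{dk}$ that does not contain any $v$ distinct points $x_1, \dots, x_v$ such that $p(x_1, \dots, x_v) = 0$. -/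

import Mathlib

/-! Put `K = k - 1` and `β = d * (K + 1)`. At points of `ℤ ^ n / N` a polynomial of degree at most
`d` with coefficients in `V` takes values `(b + ∑ αᵢ tᵢ) / (D N ^ d)` with integers `b`, `αᵢ` and
`αᵢ = O(N ^ d)`. Approximating the `tᵢ` simultaneously with one denominator `q = O(N ^ (d K))` puts
all these values near multiples of one `h ≳ N ^ (-β)` (`exists_near_multiples`). If a partial
derivative is close to `D ≠ 0`, shifting one of the points by `h / (2 D)` moves the values near
half-odd multiples of `h`, hence away from `0`, even on balls of radius about `N ^ (-β)`
(`exists_perturbed_lattice`).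

A zero of `p` may be singular, but some iterated derivative of `p` vanishes there with nonzero
gradient, and it still has degree at most `d` and coefficients in `V`
(`exists_iteratedPDeriv_regular`). There are countably many choices of derivative, direction and
disjoint basic open sets around the points; each is treated at infinitely many stages of a Cantor
construction.

Stage `j` of the Cantor set consists of balls of radius about `N_j ^ (-β)` around a perturbed
lattice of mesh `1 / N_j`. With `N_j` growing fast, its dimension is `n / β` (`exists_dimH_eq`):
counting balls bounds it above, and a coding of the unit cube with Hölder inverse bounds it below.
-/

/-! ### Diophantine approximation: polynomial values on a lattice. -/

/-- Simultaneous Dirichlet approximation. -/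
theorem exists_simultaneous_approx {K : ℕ} (t : Fin K → ℝ) {Q : ℕ} (hQ : 0 < Q) :
    ∃ q : ℕ, 0 < q ∧ q ≤ Q ^ K ∧ ∃ r : Fin K → ℤ, ∀ i, |q * t i - r i| ≤ 1 / Q := by
  have hQ' : (0 : ℝ) < Q := by exact_mod_cast hQ
  have hlt : ∀ x : ℝ, ⌊Int.fract x * Q⌋₊ < Q := fun x => by
    rw [Nat.floor_lt (by have := Int.fract_nonneg x; positivity)]
    nlinarith [Int.fract_lt_one x]
  -- Pigeonhole: `Q ^ K + 1` multiples of `t` fall into `Q ^ K` boxes of side `1 / Q` modulo `1`.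
  let f : Fin (Q ^ K + 1) → (Fin K → Fin Q) := fun m i => ⟨⌊Int.fract (m * t i) * Q⌋₊, hlt _⟩
  obtain ⟨a, b, hab, hf⟩ := Fintype.exists_ne_map_eq_of_card_lt f (by simp)
  wlog h : a < b generalizing a b
  · exact this b a hab.symm hf.symm (lt_of_le_of_ne (not_lt.1 h) hab.symm)
  have h' : (a : ℕ) < b := h
  refine ⟨b - a, by omega, by omega, fun i => ⌊(b : ℝ) * t i⌋ - ⌊(a : ℝ) * t i⌋, fun i => ?_⟩
  have hi : ⌊Int.fract ((a : ℝ) * t i) * Q⌋₊ = ⌊Int.fract ((b : ℝ) * t i) * Q⌋₊ := by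
    have := congrArg Fin.val (congrFun hf i)
    simpa [f] using this
  have ha0 := Int.fract_nonneg ((a : ℝ) * t i)
  have hb0 := Int.fract_nonneg ((b : ℝ) * t i)
  have h1 := Nat.floor_le (a := Int.fract ((a : ℝ) * t i) * Q) (by positivity)
  have h2 := Nat.floor_le (a := Int.fract ((b : ℝ) * t i) * Q) (by positivity)
  have h3 := Nat.lt_floor_add_one (Int.fract ((a : ℝ) * t i) * Q)
  have h4 := Nat.lt_floor_add_one (Int.fract ((b : ℝ) * t i) * Q)
  rw [← hi] at h2 h4
  rw [Nat.cast_sub h'.le]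
  push_cast
  have e : ((b : ℝ) - a) * t i - (⌊(b : ℝ) * t i⌋ - ⌊(a : ℝ) * t i⌋)
      = Int.fract ((b : ℝ) * t i) - Int.fract ((a : ℝ) * t i) := by
    unfold Int.fract; ring
  rw [e, le_div_iff₀ hQ', ← abs_of_pos hQ', ← abs_mul, abs_le]
  constructor <;> nlinarith

theorem exists_int_combination_of_mem_span {K : ℕ} (t : Fin K → ℝ) {c : ℝ}
    (hc : c ∈ Submodule.span ℚ (insert (1 : ℝ) (Set.range t))) :
    ∃ D : ℕ, 0 < D ∧ ∃ (b : ℤ) (α : Fin K → ℤ), D * c = b + ∑ i, α i * t i := by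
  induction hc using Submodule.span_induction with
  | mem x hx =>
    rcases hx with rfl | ⟨i, rfl⟩
    · exact ⟨1, one_pos, 1, 0, by simp⟩
    · exact ⟨1, one_pos, 0, Pi.single i 1, by simp [Pi.single_apply]⟩
  | zero => exact ⟨1, one_pos, 0, 0, by simp⟩
  | add x y _ _ hx hy =>
    obtain ⟨D, hD, b, α, h⟩ := hx
    obtain ⟨D', hD', b', α', h'⟩ := hy
    refine ⟨D * D', by positivity, D' * b + D * b', fun i => D' * α i + D * α' i, ?_⟩
    push_cast
    simp only [add_mul, Finset.sum_add_distrib, mul_assoc, ← Finset.mul_sum]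
    linear_combination (D' : ℝ) * h + (D : ℝ) * h'
  | smul a x _ hx =>
    obtain ⟨D, hD, b, α, h⟩ := hx
    refine ⟨a.den * D, by have := a.den_pos; positivity, a.num * b, fun i => a.num * α i, ?_⟩
    push_cast
    simp only [mul_assoc, ← Finset.mul_sum]
    have ha : (a.den : ℝ) * (a : ℝ) = a.num := by exact_mod_cast Rat.den_mul_eq_num a
    rw [Rat.smul_def]
    linear_combination (D * x : ℝ) * ha + (a.num : ℝ) * h

section

open MvPolynomial

variable {σ : Type*} [Fintype σ]

theorem exists_int_monomial_value {d : ℕ} {m : σ →₀ ℕ} (hm : (m.sum fun _ e => e) ≤ d) {N : ℕ}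
    (hN : 1 ≤ N) {a : σ → ℤ} (ha : ∀ i, |a i| ≤ 2 * N) :
    ∃ z : ℤ, |z| ≤ 2 ^ d * (N : ℤ) ^ d ∧
      (N : ℝ) ^ d * (m.prod fun i e => ((a i : ℝ) / N) ^ e) = z := by
  have hN0 : (N : ℝ) ≠ 0 := by positivity
  have hs : (m.sum fun _ e => e) = ∑ i, m i := Finsupp.sum_fintype _ _ (by simp)
  rw [hs] at hm
  refine ⟨(N : ℤ) ^ (d - ∑ i, m i) * ∏ i, a i ^ m i, ?_, ?_⟩
  · rw [abs_mul, Finset.abs_prod]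
    have h1 : ∏ i, |a i ^ m i| ≤ ∏ i, (2 * (N : ℤ)) ^ m i :=
      Finset.prod_le_prod (fun i _ => abs_nonneg _) fun i _ => by
        rw [abs_pow]; exact pow_le_pow_left₀ (abs_nonneg _) (ha i) _
    rw [Finset.prod_pow_eq_pow_sum, mul_pow] at h1
    have h2 : (2 : ℤ) ^ (∑ i, m i) ≤ 2 ^ d := pow_le_pow_right₀ (by norm_num) hm
    rw [abs_of_nonneg (by positivity)]
    calc (N : ℤ) ^ (d - ∑ i, m i) * ∏ i, |a i ^ m i|
        ≤ (N : ℤ) ^ (d - ∑ i, m i) * (2 ^ (∑ i, m i) * (N : ℤ) ^ (∑ i, m i)) := by gcongr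
      _ = 2 ^ (∑ i, m i) * (N : ℤ) ^ d := by
        rw [← Nat.sub_add_cancel hm, pow_add]; simp; ring
      _ ≤ _ := by gcongr
  · rw [Finsupp.prod_fintype _ _ (by simp)]
    push_cast
    simp only [div_pow, Finset.prod_div_distrib, Finset.prod_pow_eq_pow_sum]
    rw [← Nat.sub_add_cancel hm, pow_add]
    simp
    field_simp

/-- Clear the denominators of the coefficients by `D` and those of the monomials by `N ^ d`. Only
the `α i` need a bound, since `b` contributes no approximation error. Taking `D` beyond `D₀` later
makes `h` as small as required. -/
theorem exists_int_combination_eval {K d : ℕ} (t : Fin K → ℝ) (p : MvPolynomial σ ℝ)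
    (hpd : p.totalDegree ≤ d)
    (hp : ∀ m, p.coeff m ∈ Submodule.span ℚ (insert (1 : ℝ) (Set.range t))) (D₀ : ℕ) :
    ∃ D : ℕ, D₀ < D ∧ ∃ C : ℕ, ∀ N : ℕ, 1 ≤ N → ∀ a : σ → ℤ, (∀ i, |a i| ≤ 2 * N) →
      ∃ (b : ℤ) (α : Fin K → ℤ), (∀ i, |α i| ≤ C * (N : ℤ) ^ d) ∧
        D * (N : ℝ) ^ d * eval (fun i => (a i : ℝ) / N) p = b + ∑ i, α i * t i := by
  have key : ∀ S ⊆ p.support, ∃ D : ℕ, 0 < D ∧ ∃ C : ℕ, ∀ N : ℕ, 1 ≤ N → ∀ a : σ → ℤ,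
      (∀ i, |a i| ≤ 2 * N) → ∃ (b : ℤ) (α : Fin K → ℤ), (∀ i, |α i| ≤ C * (N : ℤ) ^ d) ∧
        D * (N : ℝ) ^ d * (∑ m ∈ S, p.coeff m * m.prod fun i e => ((a i : ℝ) / N) ^ e)
          = b + ∑ i, α i * t i := by
    classical
    intro S
    induction S using Finset.induction_on with
    | empty => exact fun _ => ⟨1, one_pos, 0, fun N _ a _ => ⟨0, 0, by simp, by simp⟩⟩
    | insert m S hmS ih =>
      intro hS
      obtain ⟨D, hD, C, hC⟩ := ih ((Finset.subset_insert _ _).trans hS)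
      obtain ⟨D', hD', b', α', h'⟩ := exists_int_combination_of_mem_span t (hp m)
      have hm : (m.sum fun _ e => e) ≤ d :=
        (le_totalDegree (hS (Finset.mem_insert_self _ _))).trans hpd
      refine ⟨D * D', by positivity, D' * C + D * ((∑ i, (α' i).natAbs) * 2 ^ d), ?_⟩
      intro N hN a ha
      obtain ⟨b, α, hα, h⟩ := hC N hN a ha
      obtain ⟨z, hz, hz'⟩ := exists_int_monomial_value hm hN ha
      refine ⟨D' * b + D * (b' * z), fun i => D' * α i + D * (α' i * z), fun i => ?_, ?_⟩
      · have h1 : |α' i| ≤ ∑ i, |α' i| :=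
          Finset.single_le_sum (f := fun i => |α' i|) (fun _ _ => abs_nonneg _) (Finset.mem_univ i)
        calc |(D' : ℤ) * α i + D * (α' i * z)|
            ≤ |(D' : ℤ) * α i| + |(D : ℤ) * (α' i * z)| := abs_add_le _ _
          _ = D' * |α i| + D * (|α' i| * |z|) := by simp [abs_mul]
          _ ≤ D' * (C * (N : ℤ) ^ d) + D * ((∑ i, |α' i|) * (2 ^ d * (N : ℤ) ^ d)) := by
            gcongr
            exact hα i
          _ = _ := by push_cast; ring
      · rw [Finset.sum_insert hmS]
        push_cast
        simp only [add_mul, Finset.sum_add_distrib, mul_assoc, ← Finset.mul_sum]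
        have e : ∑ i, (α' i : ℝ) * (z * t i) = z * ∑ i, (α' i : ℝ) * t i := by
          rw [Finset.mul_sum]; exact Finset.sum_congr rfl fun _ _ => by ring
        rw [e]
        linear_combination (D' : ℝ) * h + (D : ℝ) * z * h' + (D : ℝ) * D' * p.coeff m * hz'
  obtain ⟨D, hD, C, hC⟩ := key _ subset_rfl
  refine ⟨D * (D₀ + 1), by nlinarith, (D₀ + 1) * C, fun N hN a ha => ?_⟩
  obtain ⟨b, α, hα, h⟩ := hC N hN a ha
  refine ⟨(D₀ + 1) * b, fun i => (D₀ + 1) * α i, fun i => ?_, ?_⟩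
  · rw [abs_mul, abs_of_nonneg (by positivity)]
    push_cast
    rw [mul_assoc]
    have := hα i
    gcongr
  · have e : eval (fun i => (a i : ℝ) / N) p
        = ∑ m ∈ p.support, p.coeff m * m.prod fun i e => ((a i : ℝ) / N) ^ e := by
      rw [eval_eq']
      simp [Finsupp.prod_fintype]
    rw [e]
    push_cast
    simp only [mul_assoc, ← Finset.mul_sum]
    linear_combination ((D₀ : ℝ) + 1) * h

/-- The values of `p` at the points of the lattice `ℤ ^ σ / N` are close to the multiples of a
number `h` which is not much smaller than `N ^ (-d (K + 1))`. -/
theorem exists_near_multiples {K d : ℕ} (t : Fin K → ℝ) (p : MvPolynomial σ ℝ)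
    (hpd : p.totalDegree ≤ d)
    (hp : ∀ m, p.coeff m ∈ Submodule.span ℚ (insert (1 : ℝ) (Set.range t)))
    {η : ℝ} (hη : 0 < η) :
    ∃ c : ℝ, 0 < c ∧ ∀ N : ℕ, 1 ≤ N → ∃ h : ℝ, c / (N : ℝ) ^ (d * (K + 1)) ≤ h ∧
      h ≤ η / (N : ℝ) ^ d ∧ ∀ a : σ → ℤ, (∀ i, |a i| ≤ 2 * N) →
        ∃ b : ℤ, |eval (fun i => (a i : ℝ) / N) p - b * h| ≤ h / 10 := by
  obtain ⟨D₀, hD₀⟩ := exists_nat_gt (1 / η)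
  obtain ⟨D, hDD, C, hC⟩ := exists_int_combination_eval t p hpd hp D₀
  have hD : 0 < D := by omega
  have hDη : 1 < η * D := by
    have : (D₀ : ℝ) < D := by exact_mod_cast hDD
    rw [div_lt_iff₀ hη] at hD₀
    nlinarith
  -- Chosen so that the total error `K * C / G` is at most `1 / 10`; the `+ 1` keeps `G` positive.
  set G : ℕ := 10 * K * C + 1 with hG
  refine ⟨1 / (D * (G : ℝ) ^ K), by positivity, fun N hN => ?_⟩
  have hN0 : (0 : ℝ) < N := by exact_mod_cast hN
  have hD0 : (0 : ℝ) < D := by exact_mod_cast hD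
  have hG0 : (0 : ℝ) < G := by positivity
  obtain ⟨q, hq, hqQ, r, hr⟩ := exists_simultaneous_approx t (Q := G * N ^ d) (by positivity)
  have hq0 : (0 : ℝ) < q := by exact_mod_cast hq
  have hqQ' : (q : ℝ) ≤ (G * (N : ℝ) ^ d) ^ K := by exact_mod_cast hqQ
  refine ⟨1 / (D * (N : ℝ) ^ d * q), ?_, ?_, fun a ha => ?_⟩
  · rw [div_div]
    apply one_div_le_one_div_of_le (by positivity)
    calc (D : ℝ) * (N : ℝ) ^ d * q ≤ D * (N : ℝ) ^ d * (G * (N : ℝ) ^ d) ^ K := by gcongr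
      _ = _ := by rw [mul_add, pow_add, mul_pow, pow_mul]; ring
  · have h1 : (1 : ℝ) ≤ q := by exact_mod_cast hq
    rw [div_le_div_iff₀ (by positivity) (by positivity)]
    calc 1 * (N : ℝ) ^ d ≤ (η * D * q) * (N : ℝ) ^ d := by gcongr; nlinarith
      _ = _ := by ring
  · obtain ⟨b, α, hα, h⟩ := hC N hN a ha
    refine ⟨q * b + ∑ i, α i * r i, ?_⟩
    set e := eval (fun i => (a i : ℝ) / N) p
    have hsum : |∑ i, (α i : ℝ) * (q * t i - r i)| ≤ 1 / 10 := by
      calc |∑ i, (α i : ℝ) * (q * t i - r i)|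
          ≤ ∑ i, |(α i : ℝ) * (q * t i - r i)| := Finset.abs_sum_le_sum_abs _ _
        _ ≤ ∑ _i : Fin K, (C * (N : ℝ) ^ d) * (1 / (G * (N : ℝ) ^ d)) := by
          refine Finset.sum_le_sum fun i _ => ?_
          rw [abs_mul]
          have h1 : |(α i : ℝ)| ≤ C * (N : ℝ) ^ d := by exact_mod_cast hα i
          have h2 := hr i
          push_cast at h2
          gcongr
        _ = K * C / G := by simp; field_simp
        _ ≤ 1 / 10 := by
          rw [div_le_iff₀ hG0, hG]; push_cast; linarith
    have e1 : e - ((q * b + ∑ i, α i * r i : ℤ) : ℝ) * (1 / (D * (N : ℝ) ^ d * q))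
        = (∑ i, (α i : ℝ) * (q * t i - r i)) * (1 / (D * (N : ℝ) ^ d * q)) := by
      have h2 : ∑ i, (α i : ℝ) * (q * t i - r i) = q * ∑ i, α i * t i - ∑ i, (α i : ℝ) * r i := by
        rw [Finset.mul_sum, ← Finset.sum_sub_distrib]
        exact Finset.sum_congr rfl fun _ _ => by ring
      rw [h2]
      push_cast
      field_simp
      linear_combination (q : ℝ) * h
    rw [e1, abs_mul, abs_of_pos (a := 1 / (D * (N : ℝ) ^ d * q)) (by positivity)]
    have : 0 < 1 / (D * (N : ℝ) ^ d * q) := by positivity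
    nlinarith

end

/-! ### Estimates for polynomials and their partial derivatives. -/

section

open MvPolynomial

variable {σ : Type*}

theorem exists_bound_eval (p : MvPolynomial σ ℝ) {R : ℝ} (hR : 0 ≤ R) :
    ∃ L : ℝ, 0 < L ∧ ∀ x : σ → ℝ, (∀ i, |x i| ≤ R) → |eval x p| ≤ L := by
  induction p using MvPolynomial.induction_on with
  | C a => exact ⟨|a| + 1, by positivity, fun x _ => by simp⟩
  | add p q hp hq =>
    obtain ⟨L, hL, h⟩ := hp
    obtain ⟨L', hL', h'⟩ := hq
    refine ⟨L + L', by positivity, fun x hx => ?_⟩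
    rw [map_add]
    exact (abs_add_le _ _).trans (add_le_add (h x hx) (h' x hx))
  | mul_X p i hp =>
    obtain ⟨L, hL, h⟩ := hp
    refine ⟨L * (R + 1), by positivity, fun x hx => ?_⟩
    rw [map_mul, eval_X, abs_mul]
    exact mul_le_mul (h x hx) ((hx i).trans (by linarith)) (abs_nonneg _) hL.le

theorem exists_lipschitz_eval (p : MvPolynomial σ ℝ) {R : ℝ} (hR : 0 ≤ R) :
    ∃ L : ℝ, 0 < L ∧ ∀ x y : σ → ℝ, (∀ i, |x i| ≤ R) → (∀ i, |y i| ≤ R) → ∀ ε : ℝ, 0 ≤ ε →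
      (∀ i, |x i - y i| ≤ ε) → |eval x p - eval y p| ≤ L * ε := by
  induction p using MvPolynomial.induction_on with
  | C a => exact ⟨1, one_pos, fun x y _ _ ε hε _ => by simpa⟩
  | add p q hp hq =>
    obtain ⟨L, hL, h⟩ := hp
    obtain ⟨L', hL', h'⟩ := hq
    refine ⟨L + L', by positivity, fun x y hx hy ε hε hxy => ?_⟩
    rw [map_add, map_add, add_sub_add_comm, add_mul]
    exact (abs_add_le _ _).trans (add_le_add (h x y hx hy ε hε hxy) (h' x y hx hy ε hε hxy))
  | mul_X p i hp =>
    obtain ⟨L, hL, h⟩ := hp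
    obtain ⟨B, hB, hb⟩ := exists_bound_eval p hR
    refine ⟨L * R + B, by positivity, fun x y hx hy ε hε hxy => ?_⟩
    rw [map_mul, map_mul, eval_X, eval_X]
    have e : eval x p * x i - eval y p * y i
        = (eval x p - eval y p) * x i + eval y p * (x i - y i) := by ring
    rw [e]
    calc _ ≤ |(eval x p - eval y p) * x i| + |eval y p * (x i - y i)| := abs_add_le _ _
      _ ≤ (L * ε) * R + B * ε := by
        rw [abs_mul, abs_mul]
        have h1 := h x y hx hy ε hε hxy
        have h2 := hx i
        have h3 := hb y hy
        have h4 := hxy i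
        gcongr
      _ = _ := by ring

theorem exists_taylor_eval [DecidableEq σ] (p : MvPolynomial σ ℝ) (j : σ) {R : ℝ} (hR : 0 ≤ R) :
    ∃ L : ℝ, 0 < L ∧ ∀ x : σ → ℝ, (∀ i, |x i| ≤ R) → ∀ s : ℝ, |s| ≤ 1 →
      |eval (x + Pi.single j s) p - eval x p - s * eval x (pderiv j p)| ≤ L * s ^ 2 := by
  induction p using MvPolynomial.induction_on with
  | C a => exact ⟨1, one_pos, fun x _ s _ => by simp; positivity⟩
  | add p q hp hq =>
    obtain ⟨L, hL, h⟩ := hp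
    obtain ⟨L', hL', h'⟩ := hq
    refine ⟨L + L', by positivity, fun x hx s hs => ?_⟩
    simp only [map_add]
    have e : ∀ a b c d e f : ℝ, a + b - (c + d) - s * (e + f)
      = (a - c - s * e) + (b - d - s * f) := fun _ _ _ _ _ _ => by ring
    rw [e, add_mul]
    exact (abs_add_le _ _).trans (add_le_add (h x hx s hs) (h' x hx s hs))
  | mul_X p i hp =>
    obtain ⟨L, hL, h⟩ := hp
    obtain ⟨B, hB, hb⟩ := exists_bound_eval (pderiv j p) hR
    refine ⟨L * (R + 1) + B, by positivity, fun x hx s hs => ?_⟩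
    simp only [map_mul, eval_X, pderiv_mul, map_add, Pi.add_apply]
    set δ : ℝ := if i = j then 1 else 0
    have e1 : (Pi.single j s : σ → ℝ) i = s * δ := by simp [Pi.single_apply, δ]
    have e2 : eval x (pderiv j (X i : MvPolynomial σ ℝ)) = δ := by
      rw [pderiv_X]
      by_cases hij : i = j
      · subst hij; simp [δ]
      · simp [δ, hij]
    have hδ : |δ| ≤ 1 := by by_cases hij : i = j <;> simp [δ, hij]
    rw [e1, e2]
    have e : ∀ a b c : ℝ, a * (x i + s * δ) - b * x i - s * (c * x i + b * δ)
      = (a - b - s * c) * (x i + s * δ) + c * (s ^ 2 * δ) := fun _ _ _ => by ring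
    rw [e]
    have h1 := h x hx s hs
    have h2 : |x i + s * δ| ≤ R + 1 := (abs_add_le _ _).trans <| add_le_add (hx i) <| by
      rw [abs_mul]; nlinarith [abs_nonneg s, abs_nonneg δ]
    have h3 := hb x hx
    have h4 : |s ^ 2 * δ| ≤ s ^ 2 := by
      rw [abs_mul, abs_of_nonneg (sq_nonneg s)]; nlinarith [sq_nonneg s]
    calc _ ≤ |(eval (x + Pi.single j s) p - eval x p - s * eval x (pderiv j p)) * (x i + s * δ)|
          + |eval x (pderiv j p) * (s ^ 2 * δ)| := abs_add_le _ _
      _ ≤ (L * s ^ 2) * (R + 1) + B * s ^ 2 := by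
        rw [abs_mul, abs_mul]
        gcongr
      _ = _ := by ring

theorem totalDegree_pderiv_le (p : MvPolynomial σ ℝ) (i : σ) :
    (pderiv i p).totalDegree ≤ p.totalDegree - 1 := by
  classical
  refine Finset.sup_le fun m hm => ?_
  have h : p.coeff (m + Finsupp.single i 1) ≠ 0 := by
    rw [mem_support_iff, coeff_pderiv] at hm
    exact fun h => hm (by simp [h])
  have h1 := le_totalDegree (mem_support_iff.2 h)
  rw [Finsupp.sum_add_index' (by simp) (by simp)] at h1
  simp at h1
  omega

/-- The iterated partial derivative of `p` in the directions listed in `l`. -/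
noncomputable def iteratedPDeriv (l : List σ) (p : MvPolynomial σ ℝ) : MvPolynomial σ ℝ :=
  l.foldl (fun q i => pderiv i q) p

theorem totalDegree_iteratedPDeriv_le (l : List σ) (p : MvPolynomial σ ℝ) :
    (iteratedPDeriv l p).totalDegree ≤ p.totalDegree := by
  induction l generalizing p with
  | nil => rfl
  | cons i l ih =>
    exact (ih (pderiv i p)).trans ((totalDegree_pderiv_le p i).trans (Nat.sub_le _ _))

theorem coeff_iteratedPDeriv_mem (V : Submodule ℚ ℝ) (l : List σ) {p : MvPolynomial σ ℝ}
    (hp : ∀ m, p.coeff m ∈ V) (m : σ →₀ ℕ) : (iteratedPDeriv l p).coeff m ∈ V := by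
  induction l generalizing p with
  | nil => exact hp m
  | cons i l ih =>
    refine ih fun m => ?_
    rw [coeff_pderiv]
    have := V.smul_mem ((m i : ℚ) + 1) (hp (m + Finsupp.single i 1))
    rw [Rat.smul_def] at this
    push_cast at this
    simpa [mul_comm] using this

/-- Induction on the degree: a nonzero polynomial with a zero is not constant, so some partial
derivative is a nonzero polynomial of smaller degree. If all of them vanish at `x`, pass to that
one. -/
theorem exists_iteratedPDeriv_regular {p : MvPolynomial σ ℝ} (hp : p ≠ 0) {x : σ → ℝ}
    (hx : eval x p = 0) :
    ∃ (l : List σ) (i : σ), eval x (iteratedPDeriv l p) = 0 ∧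
      eval x (pderiv i (iteratedPDeriv l p)) ≠ 0 := by
  induction hn : p.totalDegree using Nat.strong_induction_on generalizing p with
  | _ n ih =>
    by_cases h : ∃ i, eval x (pderiv i p) ≠ 0
    · obtain ⟨i, hi⟩ := h
      exact ⟨[], i, hx, hi⟩
    push Not at h
    have hdeg : p.totalDegree ≠ 0 := fun h0 => by
      rw [totalDegree_eq_zero_iff_eq_C] at h0
      rw [h0, eval_C] at hx
      exact hp (by rw [h0, hx, C_0])
    obtain ⟨i, hi⟩ : ∃ i, pderiv i p ≠ 0 := by
      obtain ⟨m, hm, i, hmi⟩ : ∃ m ∈ p.support, ∃ i, m i ≠ 0 := by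
        by_contra! hcon
        exact hdeg (Nat.le_zero.1 (Finset.sup_le fun m hm => by
          rw [Finsupp.sum, Finset.sum_eq_zero fun i _ => hcon m hm i]))
      refine ⟨i, fun h0 => ?_⟩
      have h1 := coeff_pderiv (i := i) p (m - Finsupp.single i 1)
      rw [h0, coeff_zero, tsub_add_cancel_of_le (by
        simpa [Finsupp.single_le_iff] using Nat.one_le_iff_ne_zero.2 hmi)] at h1
      rcases mul_eq_zero.1 h1.symm with h2 | h2
      · exact mem_support_iff.1 hm h2
      · have : (0 : ℝ) ≤ ((m - Finsupp.single i 1 : σ →₀ ℕ) i : ℝ) := Nat.cast_nonneg _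
        linarith
    obtain ⟨l, j, h1, h2⟩ := ih _ (by have := totalDegree_pderiv_le p i; omega) hi (h i) rfl
    exact ⟨i :: l, j, h1, h2⟩

end

/-! ### Avoiding zeros near a perturbed lattice. -/

section

open MvPolynomial

/-- Perturbing the lattice `ℤ ^ n / N` slightly, one avoids the zeros of `q` in a product of sets
where some partial derivative of `q` is almost constant. -/
theorem exists_perturbed_lattice {n v d K : ℕ} (hd : 1 ≤ d) (t : Fin K → ℝ)
    (q : MvPolynomial (Fin v × Fin n) ℝ) (hqd : q.totalDegree ≤ d)
    (hq : ∀ m, q.coeff m ∈ Submodule.span ℚ (insert (1 : ℝ) (Set.range t)))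
    (i₀ : Fin v) (c₀ : Fin n) (B : Fin v → Set (Fin n → ℝ))
    (hB : ∀ i, i ≠ i₀ → Disjoint (B i₀) (B i)) {D : ℝ} (hD : D ≠ 0)
    (hDq : ∀ y : Fin v → Fin n → ℝ, (∀ i, y i ∈ B i) →
      |eval (fun ij => y ij.1 ij.2) (pderiv (i₀, c₀) q) - D| ≤ |D| / 4) :
    ∃ c : ℝ, 0 < c ∧ c ≤ 1 / 8 ∧ ∀ N : ℕ, 1 ≤ N → ∃ Y : (Fin n → ℤ) → Fin n → ℝ,
      (∀ a i, |Y a i - a i / N| ≤ 1 / (4 * N)) ∧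
      ∀ (x : Fin v → Fin n → ℝ) (a : Fin v → Fin n → ℤ),
        (∀ i k, |x i k - Y (a i) k| ≤ c / (N : ℝ) ^ (d * (K + 1))) →
        (∀ i, (fun k => (a i k : ℝ) / N) ∈ B i) → (∀ i k, |a i k| ≤ 2 * N) →
        eval (fun ij => x ij.1 ij.2) q ≠ 0 := by
  classical
  have hD0 : 0 < |D| := abs_pos.2 hD
  obtain ⟨L₁, hL₁, hlip⟩ := exists_lipschitz_eval q (R := 4) (by norm_num)
  obtain ⟨L₂, hL₂, htay⟩ := exists_taylor_eval q (i₀, c₀) (R := 2) (by norm_num)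
  -- The first bound in `η` keeps the shift below `1 / (4 N)`; the second makes the quadratic Taylor
  -- error at most `h / 20`.
  obtain ⟨c₁, hc₁, hval⟩ := exists_near_multiples t q hqd hq
    (η := min (|D| / 2) (D ^ 2 / (5 * L₂))) (by positivity)
  refine ⟨min (1 / 8) (c₁ / (10 * L₁)), by positivity, min_le_left _ _, fun N hN => ?_⟩
  have hN1 : (1 : ℝ) ≤ N := by exact_mod_cast hN
  have hN0 : (0 : ℝ) < N := by positivity
  obtain ⟨h, hh₁, hh₂, hb⟩ := hval N hN
  have hh0 : 0 < h := lt_of_lt_of_le (by positivity) hh₁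
  have hNd : (N : ℝ) ≤ (N : ℝ) ^ d := le_self_pow₀ hN1 (by omega)
  have hhD : h ≤ |D| / 2 / N := hh₂.trans (by gcongr; exact min_le_left _ _)
  have hhL : h ≤ D ^ 2 / (5 * L₂) := hh₂.trans <| by
    rw [div_le_iff₀ (by positivity)]
    exact (min_le_right _ _).trans (le_mul_of_one_le_right (by positivity) (hN1.trans hNd))
  set s : ℝ := h / (2 * D) with hs
  have hsabs : |s| = h / (2 * |D|) := by rw [hs, abs_div, abs_mul, abs_of_pos hh0]; norm_num
  have hsN : |s| ≤ 1 / (4 * N) := by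
    rw [hsabs]
    rw [le_div_iff₀ hN0] at hhD
    rw [div_le_div_iff₀ (by positivity) (by positivity)]
    nlinarith
  have hN4 : 1 / (4 * (N : ℝ)) ≤ 1 := by
    rw [div_le_one (by positivity)]; linarith
  -- Only lattice points in `B i₀` are shifted. As `B i₀` is disjoint from the other `B i`, a
  -- configuration moves only in the variable `(i₀, c₀)`.
  refine ⟨fun a k => (a k : ℝ) / N +
    if (fun k => (a k : ℝ) / N) ∈ B i₀ ∧ k = c₀ then s else 0, fun a i => ?_, ?_⟩
  · rw [add_sub_cancel_left]
    split_ifs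
    · exact hsN
    · simp
  intro x a hx hmem ha hzero
  set y : Fin v × Fin n → ℝ := fun ij => (a ij.1 ij.2 : ℝ) / N with hy
  have hyR : ∀ ij, |y ij| ≤ 2 := fun ij => by
    have : |(a ij.1 ij.2 : ℝ)| ≤ 2 * N := by exact_mod_cast ha ij.1 ij.2
    rw [hy, abs_div, abs_of_pos hN0, div_le_iff₀ hN0]
    exact this
  obtain ⟨z, hzdef⟩ : ∃ z : Fin v × Fin n → ℝ, z = y + Pi.single (i₀, c₀) s := ⟨_, rfl⟩
  have hshift : ∀ ij : Fin v × Fin n, (a ij.1 ij.2 : ℝ) / N +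
      (if (fun k => (a ij.1 k : ℝ) / N) ∈ B i₀ ∧ ij.2 = c₀ then s else 0)
      = z ij := fun ij => by
    rw [hzdef, Pi.add_apply, Pi.single_apply]
    congr 2
    rw [Prod.ext_iff, eq_iff_iff]
    refine and_congr_left fun _ => ⟨fun hm => ?_, fun hm => hm ▸ hmem _⟩
    by_contra hne
    exact Set.disjoint_left.1 (hB _ hne) hm (hmem _)
  have hz : ∀ ij, |z ij| ≤ 3 := fun ij => by
    rw [hzdef, Pi.add_apply, Pi.single_apply]
    refine (abs_add_le _ _).trans ?_
    have := hyR ij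
    split_ifs
    · linarith
    · simp; linarith
  have hρ : min (1 / 8) (c₁ / (10 * L₁)) / (N : ℝ) ^ (d * (K + 1)) ≤ 1 := by
    rw [div_le_one (by positivity)]
    exact (min_le_left _ _).trans (le_trans (by norm_num) (one_le_pow₀ hN1))
  have hxz : ∀ ij : Fin v × Fin n, |x ij.1 ij.2 - z ij|
      ≤ min (1 / 8) (c₁ / (10 * L₁)) / (N : ℝ) ^ (d * (K + 1)) := fun ij => by
    rw [← hshift]; exact hx ij.1 ij.2
  have e₁ := hlip (fun ij => x ij.1 ij.2) z
    (fun ij => by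
      have h1 := hxz ij
      have h2 := hz ij
      have h3 := abs_add_le (x ij.1 ij.2 - z ij)
        (z ij)
      rw [sub_add_cancel] at h3
      linarith)
    (fun ij => (hz ij).trans (by norm_num)) _ (by positivity) hxz
  have e₁' : L₁ * (min (1 / 8) (c₁ / (10 * L₁)) / (N : ℝ) ^ (d * (K + 1))) ≤ h / 10 :=
    calc _ ≤ L₁ * (c₁ / (10 * L₁) / (N : ℝ) ^ (d * (K + 1))) := by gcongr; exact min_le_right _ _
      _ = c₁ / (N : ℝ) ^ (d * (K + 1)) / 10 := by field_simp
      _ ≤ h / 10 := by gcongr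
  have e₂ := htay y hyR s (hsN.trans hN4)
  rw [← hzdef] at e₂
  have e₂' : L₂ * s ^ 2 ≤ h / 20 := by
    have h1 : L₂ * s ^ 2 = h * (h * L₂ / (4 * D ^ 2)) := by rw [hs]; field_simp; ring
    have h2 : h * L₂ / (4 * D ^ 2) ≤ 1 / 20 := by
      rw [le_div_iff₀ (by positivity)] at hhL
      rw [div_le_div_iff₀ (by positivity) (by norm_num)]
      linarith
    rw [h1]
    nlinarith
  have e₃ : |s * eval y (pderiv (i₀, c₀) q) - h / 2| ≤ h / 8 := by
    have h1 := hDq (fun i k => (a i k : ℝ) / N) hmem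
    have h2 : s * eval y (pderiv (i₀, c₀) q) - h / 2
        = s * (eval y (pderiv (i₀, c₀) q) - D) := by rw [hs]; field_simp
    rw [h2, abs_mul]
    calc _ ≤ |s| * (|D| / 4) := by gcongr
      _ = h / 8 := by rw [hsabs]; field_simp; ring
  obtain ⟨b, e₄⟩ := hb (fun ij => a ij.1 ij.2) fun ij => ha ij.1 ij.2
  rw [hzero] at e₁
  have e₁'' := e₁.trans e₁'
  have e₂'' := e₂.trans e₂'
  have e₄' : |eval y q - b * h| ≤ h / 10 := e₄
  rw [abs_le] at e₁'' e₂'' e₃ e₄'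
  obtain ⟨h1, h2⟩ := e₁''
  obtain ⟨h3, h4⟩ := e₂''
  obtain ⟨h5, h6⟩ := e₃
  obtain ⟨h7, h8⟩ := e₄'
  -- The errors add up to `h / 10 + h / 20 + h / 8 + h / 10 = 3 h / 8 < h / 2`, so a zero would put
  -- `b * h` strictly between `-h` and `0`.
  have h9 : b < 0 := by
    by_contra! hcon
    have hb0 : (0 : ℝ) ≤ b := by exact_mod_cast hcon
    have := mul_nonneg hb0 hh0.le
    linarith
  have h10 : -1 < b := by
    by_contra! hcon
    have hb0 : (b : ℝ) ≤ -1 := by exact_mod_cast hcon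
    have := mul_le_mul_of_nonneg_right hb0 hh0.le
    linarith
  omega

end

/-! ### Scales and coding of the Cantor set. -/

section

open Set Filter Topology

/-- An interval of length `ℓ` keeps `m ≈ ℓ N / 2` subintervals. Since `θ < 1`, the factor `N ^ (1 -
θ)` absorbs all constants once `N` is large. -/
theorem exists_scale {β : ℕ} (hβ : 1 ≤ β) {c ℓ θ : ℝ} (hc : 0 < c) (hℓ : 0 < ℓ) (hθ0 : 0 < θ)
    (hθ : θ < 1) (N₀ : ℕ) :
    ∃ N m : ℕ, N₀ ≤ N ∧ 1 ≤ N ∧ 2 ≤ m ∧ ℓ * N / 2 ≤ m ∧ m + 2 ≤ ℓ * N ∧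
      (1 / (c / (N : ℝ) ^ β)) ^ (θ / β) ≤ m := by
  have h1 : Tendsto (fun N : ℕ => (N : ℝ) ^ (1 - θ)) atTop atTop :=
    (tendsto_rpow_atTop (by linarith)).comp tendsto_natCast_atTop_atTop
  have h2 : Tendsto (fun N : ℕ => ℓ * (N : ℝ)) atTop atTop :=
    tendsto_natCast_atTop_atTop.const_mul_atTop hℓ
  obtain ⟨N, hN1, hN2, hN3, hN4⟩ := ((h1.eventually_ge_atTop ((1 / c) ^ (θ / β) / (ℓ / 2))).and
    ((h2.eventually_ge_atTop 8).and ((eventually_ge_atTop N₀).and (eventually_ge_atTop 1)))).exists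
  have hN0 : (0 : ℝ) < N := by exact_mod_cast hN4
  have hf := Nat.floor_le (a := ℓ * N / 2) (by positivity)
  have hf' := Nat.lt_floor_add_one (ℓ * N / 2)
  refine ⟨N, ⌊ℓ * N / 2⌋₊ + 1, hN3, hN4, ?_, ?_, ?_, ?_⟩
  · have : 1 ≤ ⌊ℓ * N / 2⌋₊ := Nat.le_floor (by push_cast; linarith)
    omega
  · push_cast; exact hf'.le
  · push_cast; linarith
  · push_cast
    refine le_trans ?_ hf'.le
    have hβ0 : (β : ℝ) ≠ 0 := by positivity
    have e1 : 1 / (c / (N : ℝ) ^ β) = (1 / c) * (N : ℝ) ^ (β : ℝ) := by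
      rw [Real.rpow_natCast]; field_simp
    rw [e1, Real.mul_rpow (by positivity) (by positivity), ← Real.rpow_mul hN0.le,
      mul_div_cancel₀ _ hβ0]
    rw [div_le_iff₀ (by positivity)] at hN1
    calc _ ≤ ((N : ℝ) ^ (1 - θ) * (ℓ / 2)) * (N : ℝ) ^ θ := by gcongr
      _ = ((N : ℝ) ^ (1 - θ) * (N : ℝ) ^ θ) * (ℓ / 2) := by ring
      _ = ℓ * N / 2 := by rw [← Real.rpow_add hN0]; simp; ring

theorem exists_scales {β : ℕ} (hβ : 1 ≤ β) (c : ℕ → ℝ) (hc : ∀ j, 0 < c j)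
    (N₀ : ℕ → ℕ) :
    ∃ (N m : ℕ → ℕ) (ℓ : ℕ → ℝ), ℓ 0 = 1 ∧ (∀ j, ℓ (j + 1) = c j / (N j : ℝ) ^ β) ∧
      (∀ j, 0 < ℓ j) ∧ (∀ j, N₀ j ≤ N j) ∧ (∀ j, 1 ≤ N j) ∧ (∀ j, 2 ≤ m j) ∧
      (∀ j, ℓ j * N j / 2 ≤ m j) ∧ (∀ j, m j + 2 ≤ ℓ j * N j) ∧
      ∀ j, (1 / ℓ (j + 1)) ^ (((j + 1 : ℝ) / (j + 2)) / β) ≤ m j := by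
  have step : ∀ (j : ℕ) (ℓ : ℝ), ∃ N m : ℕ, 0 < ℓ → N₀ j ≤ N ∧ 1 ≤ N ∧ 2 ≤ m ∧
      ℓ * N / 2 ≤ m ∧ m + 2 ≤ ℓ * N ∧
      (1 / (c j / (N : ℝ) ^ β)) ^ (((j + 1 : ℝ) / (j + 2)) / β) ≤ m := fun j ℓ => by
    by_cases hℓ : 0 < ℓ
    · obtain ⟨N, m, h⟩ := exists_scale hβ (hc j) hℓ (θ := (j + 1 : ℝ) / (j + 2)) (by positivity)
        (by rw [div_lt_one (by positivity)]; linarith) (N₀ j)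
      exact ⟨N, m, fun _ => h⟩
    · exact ⟨0, 0, fun h => absurd h hℓ⟩
  choose fN fm h using step
  let ℓ : ℕ → ℝ := fun j => Nat.rec 1 (fun j l => c j / (fN j l : ℝ) ^ β) j
  have hs : ∀ j, ℓ (j + 1) = c j / (fN j (ℓ j) : ℝ) ^ β := fun j => rfl
  have hpos : ∀ j, 0 < ℓ j := fun j => by
    induction j with
    | zero => exact one_pos
    | succ j ih =>
      have h1 : (0 : ℝ) < fN j (ℓ j) := by exact_mod_cast (h j (ℓ j) ih).2.1
      rw [hs]
      exact div_pos (hc j) (by positivity)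
  have h' := fun j => h j (ℓ j) (hpos j)
  refine ⟨fun j => fN j (ℓ j), fun j => fm j (ℓ j), ℓ, rfl, hs, hpos, fun j => (h' j).1,
    fun j => (h' j).2.1, fun j => (h' j).2.2.1, fun j => (h' j).2.2.2.1,
    fun j => (h' j).2.2.2.2.1, fun j => ?_⟩
  rw [hs]
  exact (h' j).2.2.2.2.2

theorem floor_mul_sub_mem {u : ℝ} (M m : ℕ) :
    0 ≤ ⌊u * (M * m : ℕ)⌋ - m * ⌊u * M⌋ ∧ ⌊u * (M * m : ℕ)⌋ - m * ⌊u * M⌋ + 1 ≤ max 1 (m : ℤ) := by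
  have h1 := Int.floor_le (u * M)
  have h2 := Int.lt_floor_add_one (u * M)
  have e : u * ((M * m : ℕ) : ℝ) = (u * M) * m := by push_cast; ring
  rw [e]
  have hm : (0 : ℝ) ≤ m := Nat.cast_nonneg m
  constructor
  · rw [sub_nonneg, Int.le_floor]
    push_cast
    nlinarith
  · rcases Nat.eq_zero_or_pos m with rfl | hm0
    · simp
    · have hm0' : (0 : ℝ) < m := by exact_mod_cast hm0
      have : ⌊u * M * m⌋ < m * ⌊u * M⌋ + m := by
        rw [Int.floor_lt]
        push_cast
        nlinarith
      refine le_trans ?_ (le_max_right _ _)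
      omega

/-- A coding of the unit cube by the points of a Cantor set. -/
theorem exists_coding {n : ℕ} (N m : ℕ → ℕ) (ℓ : ℕ → ℝ) (hℓ0 : ℓ 0 = 1) (hℓpos : ∀ j, 0 < ℓ j)
    (hN : ∀ j, 1 ≤ N j) (hm : ∀ j, 2 ≤ m j) (hmN : ∀ j, m j + 2 ≤ ℓ j * N j)
    (hℓN : ∀ j, ℓ (j + 1) ≤ 1 / (8 * N j))
    (Y : ℕ → (Fin n → ℤ) → Fin n → ℝ) (hY : ∀ j a i, |Y j a i - a i / N j| ≤ 1 / (4 * N j)) :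
    ∃ X : (Fin n → ℝ) → Fin n → ℝ, (∀ u ∈ univ.pi fun _ => Ico (0 : ℝ) 1,
        (∀ i, X u i ∈ Icc (0 : ℝ) 1) ∧ ∀ j, ∃ a, ∀ i, |X u i - Y j a i| ≤ ℓ (j + 1)) ∧
      ∀ u ∈ univ.pi fun _ => Ico (0 : ℝ) 1, ∀ u' ∈ univ.pi fun _ => Ico (0 : ℝ) 1, u ≠ u' →
        ∃ (j : ℕ) (δ : ℝ), 0 < δ ∧ δ ≤ m j ∧
          (∀ i, |u i - u' i| ≤ 2 * δ / ∏ k ∈ Finset.range (j + 1), (m k : ℝ)) ∧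
          ∃ i, δ / (4 * N j) ≤ |X u i - X u' i| := by
  have hN0 : ∀ j, (0 : ℝ) < N j := fun j => by exact_mod_cast hN j
  set M : ℕ → ℕ := fun j => ∏ k ∈ Finset.range j, m k with hM
  have hMs : ∀ j, M (j + 1) = M j * m j := fun j => Finset.prod_range_succ _ _
  have hM2 : ∀ j, 2 ^ j ≤ M j := fun j => by
    simpa [hM] using Finset.prod_le_prod' (s := Finset.range j) fun k _ => hm k
  -- `A (j + 1) u i - m j * A j u i` is the digit of `u i` at level `j` in the mixed radix `m`.
  set A : ℕ → (Fin n → ℝ) → Fin n → ℤ := fun j u i => ⌊u i * M j⌋ with hA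
  -- `z j u` is the lower corner of the stage `j` cube of side `ℓ j` containing the coded point. The
  -- `+ 1` leaves room for the perturbation below, and `m j + 2 ≤ ℓ j * N j` leaves room above.
  obtain ⟨z, hz0, hzs⟩ : ∃ z : ℕ → (Fin n → ℝ) → Fin n → ℝ, (∀ u i, z 0 u i = 0) ∧
      ∀ j u, z (j + 1) u
        = Y j fun i => ⌈z j u i * N j⌉ + 1 + (A (j + 1) u i - m j * A j u i) :=
    ⟨fun j => Nat.rec (fun _ _ => 0) (fun j w u =>
      Y j fun i => ⌈w u i * N j⌉ + 1 + (A (j + 1) u i - m j * A j u i)) j,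
      fun _ _ => rfl, fun _ _ => rfl⟩
  have hdig : ∀ j u i, 0 ≤ A (j + 1) u i - m j * A j u i ∧
      A (j + 1) u i - m j * A j u i + 1 ≤ m j := fun j u i => by
    have h := floor_mul_sub_mem (u := u i) (M j) (m j)
    rw [← hMs, max_eq_right (by have := hm j; omega)] at h
    exact h
  have hnest : ∀ j u i, z j u i ≤ z (j + 1) u i ∧ z (j + 1) u i + ℓ (j + 1) ≤ z j u i + ℓ j := by
    intro j u i
    have h1 := hY j (fun i => ⌈z j u i * N j⌉ + 1 + (A (j + 1) u i - m j * A j u i)) i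
    rw [← hzs] at h1
    obtain ⟨h2, h3⟩ := hdig j u i
    set g : ℤ := A (j + 1) u i - m j * A j u i
    have h2' : (0 : ℝ) ≤ g := by exact_mod_cast h2
    have h3' : (g : ℝ) + 1 ≤ m j := by exact_mod_cast h3
    have h4 := Int.le_ceil (z j u i * N j)
    have h5 := Int.ceil_lt_add_one (z j u i * N j)
    have h6 := hmN j
    have h7 := hℓN j
    have e4 : 1 / (4 * (N j : ℝ)) * N j = 1 / 4 := by have := (hN0 j).ne'; field_simp
    have e8 : 1 / (8 * (N j : ℝ)) * N j = 1 / 8 := by have := (hN0 j).ne'; field_simp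
    push_cast at h1
    obtain ⟨h8, h9⟩ := abs_le.1 h1
    set w := ((⌈z j u i * N j⌉ : ℝ) + 1 + g) / N j with hw
    have ew : w * N j = (⌈z j u i * N j⌉ : ℝ) + 1 + g := by
      rw [hw, div_mul_cancel₀ _ (hN0 j).ne']
    constructor
    · refine le_of_mul_le_mul_right ?_ (hN0 j)
      have := mul_le_mul_of_nonneg_right h8 (hN0 j).le
      rw [sub_mul, neg_mul, e4] at this
      linarith
    · refine le_of_mul_le_mul_right ?_ (hN0 j)
      have h10 := mul_le_mul_of_nonneg_right h9 (hN0 j).le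
      have h11 := mul_le_mul_of_nonneg_right h7 (hN0 j).le
      rw [sub_mul, e4] at h10
      rw [e8] at h11
      rw [add_mul, add_mul]
      linarith
  have hX : ∀ u i j, (⨆ k, z k u i) ∈ Icc (z j u i) (z j u i + ℓ j) := fun u i j => by
    have := Monotone.ciSup_mem_iInter_Icc_of_antitone (f := fun k => z k u i)
      (g := fun k => z k u i + ℓ k) (monotone_nat_of_le_succ fun k => (hnest k u i).1)
      (antitone_nat_of_succ_le fun k => (hnest k u i).2)
      (fun k => by have := hℓpos k; simp only; linarith)
    exact mem_iInter.1 this j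
  refine ⟨fun u i => ⨆ k, z k u i, fun u _ => ⟨fun i => ?_, fun j => ?_⟩, ?_⟩
  · simpa [hz0, hℓ0] using hX u i 0
  · refine ⟨fun i => ⌈z j u i * N j⌉ + 1 + (A (j + 1) u i - m j * A j u i), fun i => ?_⟩
    rw [← hzs]
    obtain ⟨h1, h2⟩ := hX u i (j + 1)
    have := hℓpos (j + 1)
    rw [abs_le]
    constructor <;> linarith
  intro u hu u' hu' hne
  have hex : ∃ j, A j u ≠ A j u' := by
    obtain ⟨i, hi⟩ := Function.ne_iff.1 hne
    have hpos : 0 < |u i - u' i| := abs_pos.2 (sub_ne_zero.2 hi)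
    obtain ⟨j, hj⟩ := pow_unbounded_of_one_lt (1 / |u i - u' i|) (one_lt_two (α := ℝ))
    refine ⟨j, fun h => ?_⟩
    have h1 : ⌊u i * M j⌋ = ⌊u' i * M j⌋ := congrFun h i
    have h2 := Int.abs_sub_lt_one_of_floor_eq_floor h1
    have h3 : (2 : ℝ) ^ j ≤ M j := by exact_mod_cast hM2 j
    rw [← sub_mul, abs_mul, Nat.abs_cast] at h2
    rw [div_lt_iff₀ hpos] at hj
    nlinarith
  classical
  -- The first level at which the digits differ; it exists because `A 0` vanishes on the unit cube.
  obtain ⟨j, hj, hlt⟩ : ∃ j, A (j + 1) u ≠ A (j + 1) u' ∧ ∀ k ≤ j, A k u = A k u' := by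
    rcases hj : Nat.find hex with _ | j
    · have h0 := Nat.find_spec hex
      rw [hj] at h0
      refine absurd (funext fun i => ?_) h0
      have hfl : ∀ w ∈ univ.pi fun _ : Fin n => Ico (0 : ℝ) 1, A 0 w i = 0 := fun w hw => by
        simpa [hA, hM, Int.floor_eq_zero_iff] using hw i (mem_univ i)
      rw [hfl u hu, hfl u' hu']
    · refine ⟨j, hj ▸ Nat.find_spec hex, fun k hk => ?_⟩
      exact not_not.1 (Nat.find_min hex (by omega))
  have hzeq : ∀ k ≤ j, z k u = z k u' := by
    intro k
    induction k with
    | zero => exact fun _ => funext fun i => by rw [hz0, hz0]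
    | succ k ih =>
      intro hk
      rw [hzs, hzs, ih (by omega), hlt k (by omega), hlt (k + 1) hk]
  obtain ⟨i₁, hi₁⟩ := Function.ne_iff.1 hj
  have : Nonempty (Fin n) := ⟨i₁⟩
  -- The coordinate with the largest digit difference `δ` bounds `u - u'` in every coordinate and
  -- also separates the images.
  obtain ⟨i₀, hi₀⟩ := Finite.exists_max fun i => |A (j + 1) u i - A (j + 1) u' i|
  have hδ1 : 1 ≤ |A (j + 1) u i₀ - A (j + 1) u' i₀| :=
    (Int.one_le_abs (sub_ne_zero.2 hi₁)).trans (hi₀ i₁)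
  set δ : ℤ := |A (j + 1) u i₀ - A (j + 1) u' i₀| with hδ
  have hδ1' : (1 : ℝ) ≤ δ := by exact_mod_cast hδ1
  refine ⟨j, δ, by linarith, ?_, fun i => ?_, i₀, ?_⟩
  · have h1 := hdig j u i₀
    have h2 := hdig j u' i₀
    rw [← hlt j le_rfl] at h2
    have : δ ≤ m j := by rw [hδ, abs_le]; constructor <;> linarith
    exact_mod_cast this
  · have hMpos : (0 : ℝ) < M (j + 1) := by
      have := (Nat.pos_of_ne_zero (by positivity)).trans_le (hM2 (j + 1)); exact_mod_cast this
    have e : ∏ k ∈ Finset.range (j + 1), (m k : ℝ) = M (j + 1) := by simp [hM]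
    rw [e, le_div_iff₀ hMpos, ← Nat.abs_cast, ← abs_mul, sub_mul]
    have h1 : |((A (j + 1) u i : ℤ) : ℝ) - (A (j + 1) u' i : ℤ)| ≤ δ := by exact_mod_cast hi₀ i
    have h2 := Int.floor_le (u i * M (j + 1))
    have h3 := Int.lt_floor_add_one (u i * M (j + 1))
    have h4 := Int.floor_le (u' i * M (j + 1))
    have h5 := Int.lt_floor_add_one (u' i * M (j + 1))
    obtain ⟨h6, h7⟩ := abs_le.1 h1
    rw [abs_le]
    constructor <;> linarith
  · have h1 := hY j (fun i => ⌈z j u i * N j⌉ + 1 + (A (j + 1) u i - m j * A j u i)) i₀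
    have h2 := hY j (fun i => ⌈z j u' i * N j⌉ + 1 + (A (j + 1) u' i - m j * A j u' i)) i₀
    rw [← hzs, ← hzeq j le_rfl, ← hlt j le_rfl] at h2
    rw [← hzs] at h1
    have h3 := hX u i₀ (j + 1)
    have h4 := hX u' i₀ (j + 1)
    have h5 := hℓN j
    have e4 : 1 / (4 * (N j : ℝ)) = 1 / 4 / N j := by rw [div_div]
    have e8 : 1 / (8 * (N j : ℝ)) = 1 / 8 / N j := by rw [div_div]
    rw [e4] at h1 h2
    rw [e8] at h5
    set D : ℝ := (A (j + 1) u i₀ : ℝ) - A (j + 1) u' i₀ with hD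
    have hδD : (δ : ℝ) = |D| := by rw [hδ, hD]; push_cast; rfl
    push_cast at h1 h2
    set p := z (j + 1) u i₀
    set p' := z (j + 1) u' i₀
    -- Two perturbations cost `1 / 2` and the later stages `1 / 8`, in units of `1 / N j`; as `|D| ≥
    -- 1`, at least `3 / 8` of `|D| / N j` survives.
    have h6 : |(p - p') - D / N j| ≤ 1 / 2 / N j := by
      refine le_trans (le_of_eq ?_) ((abs_sub _ _).trans (add_le_add h1 h2) |>.trans (le_of_eq ?_))
      · congr 1
        rw [hD]
        field_simp
        ring
      · ring
    have h7 : |((⨆ k, z k u i₀) - ⨆ k, z k u' i₀) - (p - p')| ≤ 1 / 8 / N j := by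
      rw [abs_le]
      constructor <;> linarith [h3.1, h3.2, h4.1, h4.2]
    have h8 : |D| / N j ≤ |(⨆ k, z k u i₀) - ⨆ k, z k u' i₀| + 1 / 8 / N j + 1 / 2 / N j := by
      have e : |D| / N j = |D / N j| := by rw [abs_div, Nat.abs_cast]
      rw [e]
      have := abs_sub_abs_le_abs_sub (D / N j) ((⨆ k, z k u i₀) - ⨆ k, z k u' i₀)
      have h9 := abs_sub_le (D / N j) (p - p') ((⨆ k, z k u i₀) - ⨆ k, z k u' i₀)
      rw [abs_sub_comm (D / N j) (p - p'),
        abs_sub_comm (p - p') ((⨆ k, z k u i₀) - ⨆ k, z k u' i₀)] at h9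
      linarith
    rw [hδD] at hδ1' ⊢
    have h10 : |D| / (4 * N j) = |D| / N j * (1 / 4) := by field_simp
    have h11 : 1 / N j ≤ |D| / N j := by gcongr
    have h12 : 1 / 8 / (N j : ℝ) = 1 / N j * (1 / 8) := by ring
    have h13 : 1 / 2 / (N j : ℝ) = 1 / N j * (1 / 2) := by ring
    rw [h10]
    rw [h12, h13] at h8
    change _ ≤ |(⨆ k, z k u i₀) - ⨆ k, z k u' i₀|
    have h14 : 0 ≤ 1 / (N j : ℝ) := by positivity
    linarith

end

/-! ### Hausdorff dimension of the Cantor set. -/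

section

open Set Filter Topology

open scoped ENNReal NNReal

theorem exists_le_of_eventually_le_one {b : ℕ → ℝ} {J : ℕ} (hb : ∀ j, J ≤ j → b j ≤ 1) :
    ∃ C : ℝ, 0 < C ∧ ∀ j, b j ≤ C := by
  have h : ∀ j, b j ≤ 1 + ∑ i ∈ Finset.range J, |b i| := fun j => by
    rcases le_or_gt J j with hj | hj
    · have := Finset.sum_nonneg fun i (_ : i ∈ Finset.range J) => abs_nonneg (b i)
      linarith [hb j hj]
    · have := Finset.single_le_sum (f := fun i => |b i|) (fun i _ => abs_nonneg _)
        (Finset.mem_range.2 hj)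
      linarith [le_abs_self (b j)]
  exact ⟨_, by have := Finset.sum_nonneg fun i (_ : i ∈ Finset.range J) => abs_nonneg (b i)
               linarith, h⟩

/-- The inverse of `X` is `r`-Hölder and maps `X '' U` onto a set of dimension `n`. -/
theorem mul_le_dimH_image {n : ℕ} {U : Set (Fin n → ℝ)} (hU : (interior U).Nonempty)
    {X : (Fin n → ℝ) → Fin n → ℝ} {C r : ℝ≥0} (hr : 0 < r)
    (hX : ∀ u ∈ U, ∀ u' ∈ U, dist u u' ≤ C * dist (X u) (X u') ^ (r : ℝ)) :
    (r : ℝ≥0∞) * n ≤ dimH (X '' U) := by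
  have hinj : InjOn X U := fun u hu u' hu' h => by
    have := hX u hu u' hu'
    rw [h, dist_self, Real.zero_rpow (by exact_mod_cast hr.ne'), mul_zero] at this
    exact dist_le_zero.1 this
  have hinv : ∀ u ∈ U, Function.invFunOn X U (X u) = u := hinj.leftInvOn_invFunOn
  have hH : HolderOnWith C r (Function.invFunOn X U) (X '' U) := by
    rintro _ ⟨u, hu, rfl⟩ _ ⟨u', hu', rfl⟩
    rw [hinv u hu, hinv u' hu', edist_dist, edist_dist, ENNReal.ofReal_rpow_of_nonneg dist_nonneg
      r.coe_nonneg, ← ENNReal.ofReal_coe_nnreal, ← ENNReal.ofReal_mul C.coe_nonneg]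
    exact ENNReal.ofReal_le_ofReal (hX u hu u' hu')
  have himg : Function.invFunOn X U '' (X '' U) = U := by
    rw [image_image]
    exact (image_congr hinv).trans (image_id' U)
  have h := hH.dimH_image_le hr
  rw [himg, Real.dimH_of_nonempty_interior hU, Module.finrank_fin_fun,
    ENNReal.le_div_iff_mul_le (Or.inl (by exact_mod_cast hr.ne')) (Or.inl ENNReal.coe_ne_top)] at h
  rwa [mul_comm]

/-- At most `(4 N + 1) ^ n` balls of radius `N ^ (-β)` suffice, so the `n / β`-dimensional sums stay
bounded. -/
theorem dimH_le_of_lattice_covers {n β : ℕ} (hβ : 1 ≤ β) {E : Set (Fin n → ℝ)} {N : ℕ → ℕ}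
    (hN : ∀ j, j + 1 ≤ N j) (Y : ℕ → (Fin n → ℤ) → Fin n → ℝ)
    (hE : ∀ x ∈ E, ∀ j, ∃ a : Fin n → ℤ, (∀ i, |a i| ≤ 2 * N j) ∧
      ∀ i, |x i - Y j a i| ≤ 1 / (N j : ℝ) ^ β) :
    dimH E ≤ n / β := by
  have hβ0 : (β : ℝ) ≠ 0 := by positivity
  have hN1 : ∀ j, (1 : ℝ) ≤ N j := fun j => by
    have := hN j; exact_mod_cast (show 1 ≤ N j by omega)
  have hN0 : ∀ j, (0 : ℝ) < N j := fun j => zero_lt_one.trans_le (hN1 j)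
  have hdiam : ∀ j a, Metric.ediam (Metric.closedBall (Y j a) (1 / (N j : ℝ) ^ β))
      ≤ ENNReal.ofReal (2 * (1 / (N j : ℝ) ^ β)) := fun j a => by
    refine Metric.ediam_le_of_forall_dist_le fun x hx y hy => ?_
    have := dist_triangle_right x y (Y j a)
    rw [Metric.mem_closedBall] at hx hy
    linarith
  have hmeas := MeasureTheory.Measure.hausdorffMeasure_le_liminf_sum (l := atTop) (n / β : ℝ) E
    (ι := fun j => Fintype.piFinset fun _ : Fin n => Finset.Icc (-(2 * N j : ℤ)) (2 * N j))
    (fun j => ENNReal.ofReal (2 * (1 / (N j : ℝ) ^ β)))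
    (by
      rw [← ENNReal.ofReal_zero]
      refine ENNReal.tendsto_ofReal ?_
      rw [← mul_zero (2 : ℝ)]
      refine Tendsto.const_mul 2 (squeeze_zero (fun j => by positivity) (fun j => ?_)
        (tendsto_one_div_add_atTop_nhds_zero_nat (𝕜 := ℝ)))
      apply one_div_le_one_div_of_le (by positivity)
      calc (j + 1 : ℝ) ≤ N j := by exact_mod_cast hN j
        _ ≤ (N j : ℝ) ^ β := le_self_pow₀ (hN1 j) (by omega))
    (fun j a => Metric.closedBall (Y j a) (1 / (N j : ℝ) ^ β))
    (Eventually.of_forall fun j a => hdiam j a)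
    (Eventually.of_forall fun j x hx => by
      obtain ⟨a, ha, hxa⟩ := hE x hx j
      refine mem_iUnion.2 ⟨⟨a, Fintype.mem_piFinset.2 fun i => Finset.mem_Icc.2 (abs_le.1 (ha i))⟩,
        ?_⟩
      rw [Metric.mem_closedBall, dist_pi_le_iff (by have := hN0 j; positivity)]
      exact hxa)
  have hfin : MeasureTheory.Measure.hausdorffMeasure (n / β : ℝ) E
      ≤ ENNReal.ofReal (5 ^ n * 2 ^ (n / β : ℝ)) := by
    refine hmeas.trans ((liminf_le_liminf (Eventually.of_forall fun j => ?_)).trans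
      (liminf_const _).le)
    have hN0j := hN0 j
    calc ∑ a : Fintype.piFinset fun _ : Fin n => Finset.Icc (-(2 * N j : ℤ)) (2 * N j),
          Metric.ediam (Metric.closedBall (Y j a) (1 / (N j : ℝ) ^ β)) ^ (n / β : ℝ)
        ≤ ∑ _a : Fintype.piFinset fun _ : Fin n => Finset.Icc (-(2 * N j : ℤ)) (2 * N j),
          ENNReal.ofReal ((2 * (1 / (N j : ℝ) ^ β)) ^ (n / β : ℝ)) := by
          refine Finset.sum_le_sum fun a _ => ?_
          rw [← ENNReal.ofReal_rpow_of_nonneg (by positivity) (by positivity)]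
          exact ENNReal.rpow_le_rpow (hdiam j a) (by positivity)
      _ = ENNReal.ofReal ((4 * N j + 1) ^ n * (2 * (1 / (N j : ℝ) ^ β)) ^ (n / β : ℝ)) := by
          rw [Finset.sum_const, Finset.card_univ, Fintype.card_coe, Fintype.card_piFinset,
            nsmul_eq_mul, ENNReal.ofReal_mul (by positivity)]
          congr 1
          have e : (2 * N j + 1 - -(2 * N j : ℤ)).toNat = 4 * N j + 1 := by omega
          simp only [Int.card_Icc, Finset.prod_const, Finset.card_univ, Fintype.card_fin, e]
          rw [← ENNReal.ofReal_natCast]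
          push_cast
          rfl
      _ ≤ _ := by
          refine ENNReal.ofReal_le_ofReal ?_
          have e : (1 / (N j : ℝ) ^ β) ^ (n / β : ℝ) = 1 / (N j : ℝ) ^ n := by
            rw [one_div, Real.inv_rpow (by positivity), ← Real.rpow_natCast,
              ← Real.rpow_mul hN0j.le, mul_div_cancel₀ _ hβ0, Real.rpow_natCast, one_div]
          rw [Real.mul_rpow (by norm_num) (by positivity), e]
          calc (4 * (N j : ℝ) + 1) ^ n * (2 ^ (n / β : ℝ) * (1 / (N j : ℝ) ^ n))
              ≤ (5 * (N j : ℝ)) ^ n * (2 ^ (n / β : ℝ) * (1 / (N j : ℝ) ^ n)) := by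
                gcongr
                linarith [hN1 j]
            _ = _ := by rw [mul_pow]; field_simp
  have h := dimH_le_of_hausdorffMeasure_ne_top (d := (n / β : ℝ≥0)) (s := E) (by
    push_cast
    exact (hfin.trans_lt ENNReal.ofReal_lt_top).ne)
  rwa [ENNReal.coe_div (by positivity), ENNReal.coe_natCast, ENNReal.coe_natCast] at h

/-- If all the maps `Y j N` send the lattice `ℤ ^ n` close to `ℤ ^ n / N`, then there are integers
`N j` and a set of dimension `n / β` which for each `j` lies in the union of the balls of radius
`c j / N j ^ β` around the points `Y j (N j) a`. -/
theorem exists_dimH_eq {n β : ℕ} (hβ : 1 ≤ β) (c : ℕ → ℝ) (hc : ∀ j, 0 < c j)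
    (hc8 : ∀ j, c j ≤ 1 / 8) (Y : ℕ → ℕ → (Fin n → ℤ) → Fin n → ℝ)
    (hY : ∀ j N, 1 ≤ N → ∀ a i, |Y j N a i - a i / N| ≤ 1 / (4 * N)) :
    ∃ (E : Set (Fin n → ℝ)) (N : ℕ → ℕ), (∀ j, j + 1 ≤ N j) ∧ dimH E = n / β ∧
      ∀ x ∈ E, ∀ j, ∃ a : Fin n → ℤ, (∀ i, |a i| ≤ 2 * N j) ∧
        ∀ i, |x i - Y j (N j) a i| ≤ c j / (N j : ℝ) ^ β := by
  obtain ⟨N, m, ℓ, hℓ0, hℓs, hℓpos, hNj, hN, hm, hℓm, hmℓ, hrpow⟩ :=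
    exists_scales hβ c hc fun j => j + 1
  have hN1 : ∀ j, (1 : ℝ) ≤ N j := fun j => by exact_mod_cast hN j
  have hN0 : ∀ j, (0 : ℝ) < N j := fun j => zero_lt_one.trans_le (hN1 j)
  have hℓN : ∀ j, ℓ (j + 1) ≤ 1 / (8 * N j) := fun j => by
    rw [hℓs, ← div_div]
    have := hN0 j
    gcongr
    · exact hc8 j
    · exact le_self_pow₀ (hN1 j) (by omega)
  have hℓ1 : ∀ j, ℓ j ≤ 1 := fun j => by
    rcases j with _ | j
    · exact hℓ0.le
    · refine (hℓN j).trans ?_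
      rw [div_le_one (by have := hN0 j; positivity)]
      linarith [hN1 j]
  obtain ⟨X, hX, hsep⟩ := exists_coding N m ℓ hℓ0 hℓpos hN hm hmℓ hℓN (fun j => Y j (N j))
    fun j => hY j (N j) (hN j)
  have hE : ∀ x ∈ X '' univ.pi fun _ => Ico (0 : ℝ) 1, ∀ j, ∃ a : Fin n → ℤ,
      (∀ i, |a i| ≤ 2 * N j) ∧ ∀ i, |x i - Y j (N j) a i| ≤ c j / (N j : ℝ) ^ β := by
    rintro _ ⟨u, hu, rfl⟩ j
    obtain ⟨a, ha⟩ := (hX u hu).2 j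
    refine ⟨a, fun i => ?_, fun i => (hℓs j) ▸ ha i⟩
    have h1 := (hX u hu).1 i
    have h2 := (ha i).trans (hℓN j)
    have h3 := hY j (N j) (hN j) a i
    have h4 : 1 / (8 * (N j : ℝ)) + 1 / (4 * N j) ≤ 1 := by
      have : 1 / (8 * (N j : ℝ)) + 1 / (4 * N j) = 3 / 8 / N j := by
        have := (hN0 j).ne'; field_simp; norm_num
      rw [this, div_le_one (hN0 j)]
      linarith [hN1 j]
    have h5 : |(a i : ℝ) / N j| ≤ 2 := by
      rw [abs_le] at h2 h3 ⊢
      constructor <;> linarith [h1.1, h1.2]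
    rw [abs_div, Nat.abs_cast, div_le_iff₀ (hN0 j)] at h5
    exact_mod_cast h5
  refine ⟨_, N, hNj, le_antisymm ?_ ?_, hE⟩
  · refine dimH_le_of_lattice_covers hβ hNj (fun j => Y j (N j)) fun x hx j => ?_
    obtain ⟨a, ha, hxa⟩ := hE x hx j
    refine ⟨a, ha, fun i => (hxa i).trans ?_⟩
    have := hN0 j
    gcongr
    linarith [hc8 j]
  have hU : (interior (univ.pi fun _ : Fin n => Ico (0 : ℝ) 1)).Nonempty := by
    rw [interior_pi_set finite_univ]
    exact ⟨fun _ => 1 / 2, fun i _ => by rw [interior_Ico]; norm_num⟩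
  have hlow : ∀ r : ℝ≥0, 0 < r → r < 1 / (β : ℝ≥0) →
      (r : ℝ≥0∞) * n ≤ dimH (X '' univ.pi fun _ => Ico (0 : ℝ) 1) := by
    intro r hr hrβ
    have hr0 : (0 : ℝ) < r := hr
    have hβ1 : (1 : ℝ) ≤ β := by exact_mod_cast hβ
    have hrβ' : (r : ℝ) * β < 1 := by
      have : (r : ℝ) < 1 / β := by exact_mod_cast hrβ
      rwa [lt_div_iff₀ (by positivity)] at this
    have hr1 : (r : ℝ) ≤ 1 := by nlinarith
    -- From `J` on, the exponent `(j + 1) / (j + 2)` of `exists_scales` exceeds `r * β`; the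
    -- finitely many earlier levels only affect the Hölder constant.
    obtain ⟨J, hJ⟩ := exists_nat_ge (1 / (1 - r * β : ℝ))
    rw [div_le_iff₀ (by linarith)] at hJ
    have hprod : ∀ j, (1 : ℝ) ≤ ∏ k ∈ Finset.range j, (m k : ℝ) := fun j => by
      exact_mod_cast Nat.one_le_iff_ne_zero.2
        (Finset.prod_ne_zero_iff.2 fun k (_ : k ∈ Finset.range j) => by have := hm k; omega)
    obtain ⟨C, hC, hCj⟩ := exists_le_of_eventually_le_one
      (b := fun j => (1 / ℓ j) ^ (r : ℝ) / ∏ k ∈ Finset.range j, (m k : ℝ)) (J := J + 1)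
      fun j hj => by
        obtain ⟨j, rfl⟩ : ∃ i, j = i + 1 := ⟨j - 1, by omega⟩
        have hJj : (J : ℝ) ≤ j := by exact_mod_cast (show J ≤ j by omega)
        rw [div_le_one (zero_lt_one.trans_le (hprod _)), Finset.prod_range_succ]
        calc (1 / ℓ (j + 1)) ^ (r : ℝ)
            ≤ (1 / ℓ (j + 1)) ^ (((j + 1 : ℝ) / (j + 2)) / β) := by
              refine Real.rpow_le_rpow_of_exponent_le ?_ ?_
              · rw [one_le_div (hℓpos _)]; exact hℓ1 _
              · rw [le_div_iff₀ (by positivity), le_div_iff₀ (by positivity)]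
                nlinarith
          _ ≤ m j := hrpow j
          _ ≤ _ := le_mul_of_one_le_left (Nat.cast_nonneg _) (hprod j)
    refine mul_le_dimH_image (C := ⟨2 * 8 ^ (r : ℝ) * C, by positivity⟩) hU hr
      fun u hu u' hu' => ?_
    rcases eq_or_ne u u' with rfl | hne
    · rw [dist_self]; exact mul_nonneg (NNReal.coe_nonneg _) (Real.rpow_nonneg dist_nonneg _)
    obtain ⟨j, δ, hδ, hδm, hu, i, hi⟩ := hsep u hu u' hu' hne
    have hm0 : (0 : ℝ) < m j := hδ.trans_le hδm
    have hNj0 := hN0 j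
    have hℓj := hℓpos j
    have hP := zero_lt_one.trans_le (hprod j)
    have h1 : dist u u' ≤ 2 * δ / ∏ k ∈ Finset.range (j + 1), (m k : ℝ) := by
      rw [dist_pi_le_iff (by rw [Finset.prod_range_succ]; positivity)]
      exact hu
    have h2 : δ / (4 * N j) ≤ dist (X u) (X u') := hi.trans (dist_le_pi_dist (X u) (X u') i)
    have h3 : δ / m j ≤ (δ / m j) ^ (r : ℝ) := by
      conv_lhs => rw [← Real.rpow_one (δ / m j)]
      exact Real.rpow_le_rpow_of_exponent_ge (by positivity) ((div_le_one hm0).2 hδm) hr1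
    -- This uses `ℓ j * N j / 2 ≤ m j`: the kept subcubes fill a fixed proportion of each side.
    have h4 : δ / m j ≤ 8 * (1 / ℓ j) * (δ / (4 * N j)) := by
      have := hℓm j
      rw [show 8 * (1 / ℓ j) * (δ / (4 * N j)) = δ / (ℓ j * N j / 2) by field_simp; norm_num]
      gcongr
    calc dist u u' ≤ 2 * δ / ∏ k ∈ Finset.range (j + 1), (m k : ℝ) := h1
      _ = 2 * (δ / m j) / ∏ k ∈ Finset.range j, (m k : ℝ) := by
        rw [Finset.prod_range_succ]; field_simp
      _ ≤ 2 * (8 * (1 / ℓ j) * dist (X u) (X u')) ^ (r : ℝ)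
          / ∏ k ∈ Finset.range j, (m k : ℝ) := by
        gcongr
        refine h3.trans (Real.rpow_le_rpow (by positivity) (h4.trans ?_) hr0.le)
        gcongr
      _ = 2 * 8 ^ (r : ℝ) * ((1 / ℓ j) ^ (r : ℝ) / ∏ k ∈ Finset.range j, (m k : ℝ))
          * dist (X u) (X u') ^ (r : ℝ) := by
        rw [Real.mul_rpow (by positivity) dist_nonneg, Real.mul_rpow (by norm_num) (by positivity)]
        ring
      _ ≤ 2 * 8 ^ (r : ℝ) * C * dist (X u) (X u') ^ (r : ℝ) := by
        gcongr
        exact hCj j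
  rcases Nat.eq_zero_or_pos n with rfl | hn
  · simp
  have hβ0 : (β : ℝ≥0) ≠ 0 := by positivity
  have hn0 : (n : ℝ≥0∞) ≠ 0 := by positivity
  have e : (n : ℝ≥0∞) / β = ((1 / (β : ℝ≥0) : ℝ≥0) : ℝ≥0∞) * n := by
    rw [ENNReal.coe_div hβ0, ENNReal.coe_one, ENNReal.coe_natCast, mul_comm, mul_one_div]
  rw [e, ← ENNReal.le_div_iff_mul_le (Or.inl hn0) (Or.inl (ENNReal.natCast_ne_top n))]
  refine le_of_forall_lt fun a ha => ?_
  lift a to ℝ≥0 using (ha.trans ENNReal.coe_lt_top).ne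
  obtain ⟨r, har, hr⟩ := exists_between (ENNReal.coe_lt_coe.1 ha)
  refine lt_of_lt_of_le (ENNReal.coe_lt_coe.2 har) ?_
  rw [ENNReal.le_div_iff_mul_le (Or.inl hn0) (Or.inl (ENNReal.natCast_ne_top n))]
  exact hlow r ((show 0 ≤ a from bot_le).trans_lt har) hr

end

/-! ### Localisation at regular zeros and scheduling of the stages. -/

section

open MvPolynomial Set Filter Topology

theorem continuous_eval_uncurry {n v : ℕ} (q : MvPolynomial (Fin v × Fin n) ℝ) :
    Continuous fun y : Fin v → Fin n → ℝ => eval (fun ij => y ij.1 ij.2) q :=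
  (MvPolynomial.continuous_eval q).comp (by fun_prop)

/-- Around a regular point of `q` with distinct components there are disjoint basic open sets on
whose product some partial derivative of `q` is almost constant. -/
theorem exists_basis_pderiv_near {n v : ℕ} (q : MvPolynomial (Fin v × Fin n) ℝ)
    {x : Fin v → Fin n → ℝ} (hx : Function.Injective x)
    (j : Fin v × Fin n) (hj : eval (fun ij => x ij.1 ij.2) (pderiv j q) ≠ 0) :
    ∃ B : Fin v → TopologicalSpace.countableBasis (Fin n → ℝ), (∀ i, x i ∈ (B i : Set (Fin n → ℝ))) ∧
      (∀ i i', i ≠ i' → Disjoint (B i : Set (Fin n → ℝ)) (B i')) ∧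
      ∃ D : ℝ, D ≠ 0 ∧ ∀ y : Fin v → Fin n → ℝ, (∀ i, y i ∈ (B i : Set (Fin n → ℝ))) →
        |eval (fun ij => y ij.1 ij.2) (pderiv j q) - D| ≤ |D| / 4 := by
  set D := eval (fun ij => x ij.1 ij.2) (pderiv j q) with hD
  have hnear : ∀ᶠ y in 𝓝 x, |eval (fun ij => y ij.1 ij.2) (pderiv j q) - D| < |D| / 4 := by
    have := (continuous_eval_uncurry (pderiv j q)).tendsto x
    have h4 : 0 < |D| / 4 := by have := abs_pos.2 hj; positivity
    filter_upwards [this.eventually (Metric.ball_mem_nhds _ h4)] with y hy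
    simpa [Real.dist_eq] using hy
  rw [nhds_pi] at hnear
  obtain ⟨_, _, W, hW, hWsub⟩ := Filter.mem_pi.1 hnear
  obtain ⟨S, hS, hSd⟩ := Set.Finite.t2_separation (X := Fin n → ℝ) (s := range x) (finite_range x)
  have hB : ∀ i, ∃ B ∈ TopologicalSpace.countableBasis (Fin n → ℝ), x i ∈ B ∧
      B ⊆ W i ∩ S (x i) := fun i =>
    (TopologicalSpace.isBasis_countableBasis (Fin n → ℝ)).mem_nhds_iff.1
      (inter_mem (hW i) ((hS (x i)).2.mem_nhds (hS (x i)).1))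
  choose B hBm hxB hBW using hB
  refine ⟨fun i => ⟨B i, hBm i⟩, hxB, fun i i' hii => ?_, D, hj, fun y hy => ?_⟩
  · exact (hSd ⟨i, rfl⟩ ⟨i', rfl⟩ (hx.ne hii)).mono ((hBW i).trans inter_subset_right)
      ((hBW i').trans inter_subset_right)
  · exact le_of_lt (hWsub fun i _ => (hBW i (hy i)).1)

theorem exists_dimH_eq_avoiding {n v d K : ℕ} (hd : 1 ≤ d) (t : Fin K → ℝ)
    (p : MvPolynomial (Fin v × Fin n) ℝ) (hp0 : p ≠ 0) (hpd : p.totalDegree ≤ d)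
    (hp : ∀ m, p.coeff m ∈ Submodule.span ℚ (insert (1 : ℝ) (Set.range t))) :
    ∃ E : Set (Fin n → ℝ), dimH E = (n : ENNReal) / (d * (K + 1) : ℕ) ∧
      ∀ x : Fin v → Fin n → ℝ, (∀ i, x i ∈ E) → Function.Injective x →
        eval (fun ij => x ij.1 ij.2) p ≠ 0 := by
  -- A task consists of a derivative, a direction and basic open sets. `Option T` is used below
  -- because enumeration needs a nonempty type; void tasks get the unperturbed lattice.
  let T := List (Fin v × Fin n) × (Fin v × Fin n) ×
    (Fin v → TopologicalSpace.countableBasis (Fin n → ℝ))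
  have hstage : ∀ τ : Option T, ∃ c : ℝ, 0 < c ∧ c ≤ 1 / 8 ∧ ∀ N : ℕ, ∃ Y : (Fin n → ℤ) → Fin n → ℝ,
      1 ≤ N → (∀ a i, |Y a i - a i / N| ≤ 1 / (4 * N)) ∧ ∀ l j B, τ = some (l, j, B) →
      (∀ i i', i ≠ i' → Disjoint (B i : Set (Fin n → ℝ)) (B i')) →
      (∃ D : ℝ, D ≠ 0 ∧ ∀ y : Fin v → Fin n → ℝ, (∀ i, y i ∈ (B i : Set (Fin n → ℝ))) →
        |eval (fun ij => y ij.1 ij.2) (pderiv j (iteratedPDeriv l p)) - D| ≤ |D| / 4) →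
      ∀ (x : Fin v → Fin n → ℝ) (a : Fin v → Fin n → ℤ),
        (∀ i k, |x i k - Y (a i) k| ≤ c / (N : ℝ) ^ (d * (K + 1))) →
        (∀ i, (fun k => (a i k : ℝ) / N) ∈ (B i : Set (Fin n → ℝ))) → (∀ i k, |a i k| ≤ 2 * N) →
        eval (fun ij => x ij.1 ij.2) (iteratedPDeriv l p) ≠ 0 := by
    have htriv : ∀ N : ℕ, ∀ (a : Fin n → ℤ) (i : Fin n),
        |(a i : ℝ) / N - a i / N| ≤ 1 / (4 * N) := fun N a i => by
      rw [sub_self, abs_zero]; positivity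
    rintro (_ | ⟨l, ⟨i₀, c₀⟩, B⟩)
    · exact ⟨1 / 8, by norm_num, le_rfl, fun N => ⟨fun a i => a i / N, fun _ =>
        ⟨htriv N, fun _ _ _ h => by simp at h⟩⟩⟩
    by_cases h : (∀ i i', i ≠ i' → Disjoint (B i : Set (Fin n → ℝ)) (B i')) ∧
      (∃ D : ℝ, D ≠ 0 ∧ ∀ y : Fin v → Fin n → ℝ, (∀ i, y i ∈ (B i : Set (Fin n → ℝ))) →
        |eval (fun ij => y ij.1 ij.2) (pderiv (i₀, c₀) (iteratedPDeriv l p)) - D| ≤ |D| / 4)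
    · obtain ⟨h1, D, hD, h2⟩ := h
      obtain ⟨c, hc, hc8, hY⟩ := exists_perturbed_lattice hd t (iteratedPDeriv l p)
        ((totalDegree_iteratedPDeriv_le l p).trans hpd) (coeff_iteratedPDeriv_mem _ l hp) i₀ c₀
        (fun i => B i) (fun i hi => h1 _ _ hi.symm) hD h2
      refine ⟨c, hc, hc8, fun N => ?_⟩
      by_cases hN : 1 ≤ N
      · obtain ⟨Y, hY1, hY2⟩ := hY N hN
        refine ⟨Y, fun _ => ⟨hY1, fun l' j' B' he _ _ => ?_⟩⟩
        cases he
        exact hY2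
      · exact ⟨0, fun h => absurd h hN⟩
    · refine ⟨1 / 8, by norm_num, le_rfl, fun N => ⟨fun a i => a i / N, fun _ =>
        ⟨htriv N, fun l' j' B' he h1 h2 => ?_⟩⟩⟩
      cases he
      exact absurd ⟨h1, h2⟩ h
  choose c hc hc8 Y hY using hstage
  have : Countable (TopologicalSpace.countableBasis (Fin n → ℝ)) :=
    (TopologicalSpace.countable_countableBasis (Fin n → ℝ)).to_subtype
  obtain ⟨f, hf⟩ := exists_surjective_nat (Option T)
  -- Unpairing repeats each task infinitely often: the lattice points near `x i` lie in `B i` only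
  -- from some stage `k₀` on.
  let τ : ℕ → Option T := fun j => f (Nat.unpair j).1
  have hβ : 1 ≤ d * (K + 1) := Nat.mul_pos hd K.succ_pos
  obtain ⟨E, N, hN, hdim, hE⟩ := exists_dimH_eq (n := n) hβ (fun j => c (τ j)) (fun j => hc _)
    (fun j => hc8 _) (fun j => Y (τ j)) fun j N hN => (hY (τ j) N hN).1
  refine ⟨E, hdim, fun x hxE hx hzero => ?_⟩
  obtain ⟨l, j, hl0, hlj⟩ := exists_iteratedPDeriv_regular hp0 hzero
  obtain ⟨B, hxB, hBd, hD⟩ := exists_basis_pderiv_near (iteratedPDeriv l p) hx j hlj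
  obtain ⟨s, hs⟩ := hf (some (l, j, B))
  choose a ha hxa using fun i => hE (x i) (hxE i)
  have hN1 : ∀ k, (1 : ℝ) ≤ N k := fun k => by
    have := hN k; exact_mod_cast (show 1 ≤ N k by omega)
  have hlim : ∀ i, Tendsto (fun k => (fun m => (a i k m : ℝ) / N k)) atTop (𝓝 (x i)) := fun i => by
    rw [tendsto_pi_nhds]
    refine fun m => tendsto_iff_norm_sub_tendsto_zero.2 (squeeze_zero (fun _ => norm_nonneg _)
      (fun k => ?_) (tendsto_one_div_add_atTop_nhds_zero_nat (𝕜 := ℝ)))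
    have hN0 : (0 : ℝ) < N k := zero_lt_one.trans_le (hN1 k)
    have h1 := (hY (τ k) (N k) (by have := hN k; omega)).1 (a i k) m
    have h2 := hxa i k m
    have h3 : c (τ k) / (N k : ℝ) ^ (d * (K + 1)) ≤ 1 / 8 / N k := by
      gcongr
      · exact hc8 _
      · exact le_self_pow₀ (hN1 k) (by omega)
    have h4 : 1 / (4 * (N k : ℝ)) = 1 / N k * (1 / 4) := by field_simp
    have h5 : 1 / 8 / (N k : ℝ) = 1 / N k * (1 / 8) := by field_simp
    have h6 : 0 < 1 / (N k : ℝ) := by positivity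
    have h7 : 1 / (N k : ℝ) ≤ 1 / (k + 1) := by
      apply one_div_le_one_div_of_le (by positivity)
      exact_mod_cast hN k
    rw [Real.norm_eq_abs]
    refine le_trans ?_ h7
    rw [abs_le] at h1 h2 ⊢
    constructor <;> linarith
  have hev : ∀ᶠ k in atTop, ∀ i, (fun m => (a i k m : ℝ) / N k) ∈ (B i : Set (Fin n → ℝ)) :=
    eventually_all.2 fun i => (hlim i).eventually
      (((TopologicalSpace.isBasis_countableBasis _).isOpen (B i).2).mem_nhds (hxB i))
  obtain ⟨k₀, hk₀⟩ := eventually_atTop.1 hev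
  set k := Nat.pair s k₀ with hk
  have hτ : τ k = some (l, j, B) := by simp [τ, hk, hs]
  exact (hY (τ k) (N k) (by have := hN k; omega)).2 l j B hτ hBd hD x (fun i => a i k)
    (fun i m => hxa i k m) (hk₀ k (Nat.right_le_pair _ _)) (fun i m => ha i k m) hl0

end

theorem mainTheorem6 (n v d k : ℕ) (hd : 1 ≤ d)
    (t : Fin (k - 1) → ℝ)
    (ht : Module.finrank ℚ (Submodule.span ℚ (insert (1 : ℝ) (Set.range t))) = k)
    (p : MvPolynomial (Fin v × Fin n) ℝ)
    (hpd : p.totalDegree = d)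
    (hp : ∀ m, p.coeff m ∈ Submodule.span ℚ (insert (1 : ℝ) (Set.range t))) :
    ∃ E : Set (EuclideanSpace ℝ (Fin n)),
      dimH E = (n : ENNReal) / ((d : ENNReal) * (k : ENNReal)) ∧
      ∀ x : Fin v → EuclideanSpace ℝ (Fin n), (∀ i, x i ∈ E) → Function.Injective x →
        MvPolynomial.eval (fun ij : Fin v × Fin n => x ij.1 ij.2) p ≠ 0 := by
  -- Needed for `k - 1 + 1 = k` with truncated subtraction; the span contains `1`, so its dimension
  -- is not `0`.
  have hk : k ≠ 0 := by
    rintro rfl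
    have : FiniteDimensional ℚ (Submodule.span ℚ (insert (1 : ℝ) (Set.range t))) :=
      FiniteDimensional.span_of_finite ℚ ((Set.finite_range t).insert 1)
    rw [Submodule.finrank_eq_zero] at ht
    have h1 : (1 : ℝ) ∈ Submodule.span ℚ (insert (1 : ℝ) (Set.range t)) :=
      Submodule.subset_span (Set.mem_insert _ _)
    rw [ht, Submodule.mem_bot] at h1
    exact one_ne_zero h1
  have hp0 : p ≠ 0 := by
    rintro rfl
    rw [MvPolynomial.totalDegree_zero] at hpd
    omega
  obtain ⟨E, hdim, hE⟩ := exists_dimH_eq_avoiding hd t p hp0 hpd.le hp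
  -- The construction used the sup norm; a continuous linear equivalence preserves Hausdorff
  -- dimension.
  let e := EuclideanSpace.equiv (Fin n) ℝ
  refine ⟨e.symm '' E, ?_, fun x hx hinj => ?_⟩
  · rw [ContinuousLinearEquiv.dimH_image, hdim, Nat.sub_add_cancel (Nat.one_le_iff_ne_zero.2 hk)]
    push_cast
    rfl
  · refine hE (fun i => e (x i)) (fun i => ?_) (e.injective.comp hinj)
    obtain ⟨y, hy, hyx⟩ := hx i
    rw [← hyx, e.apply_symm_apply]
    exact hy
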